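/- Let $\omega=e^{i\pi/4}$ and $R=\mathbb{Z}[i,1/\sqrt2]\subset\mathbb{C}$. For $x,y\in R$ and $k\in\mathbb{Z}$ put $$U[x,y,k]=\begin{pmatrix} x & -\overline{y}\,\omega^k\\ y & \overline{x}\,\omega^k\end{pmatrix}.$$ The single-qubit Clifford unitaries are the finite products of $X=\begin{pmatrix}0&1\\1&0\end{pmatrix}$, $Z=\begin{pmatrix}1&0\\0&-1\end{pmatrix}$, $Y=iXZ$, $H=\frac1{\sqrt2}\begin{pmatrix}1&1\\1&-1\end{pmatrix}$ and $P=T^2$, where $T=\begin{pmatrix}1&0\\0&\omega\end{pmatrix}$. The T-count $\mathrm{T}(U)$ of a $2\times2$ unitary $U$ is the least $n\ge0$ for which $U=e^{i\alpha}C_1TC_2T\cdots C_nTC_{n+1}$ with $\alpha\in\mathbb{R}$ and Clifford unitaries $C_j$ ($\infty$ if there is no such $n$). For $x\in R$ and $k\in\mathbb{Z}$ let $$\mathrm{T}_k(x)=\min\{\mathrm{T}(U[x,y,k]) : y\in R,\ U[x,y,k]\text{ unitary}\},$$ with $\mathrm{T}_k(x)=\infty$ if the set is empty. **Proposition.** Let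 $k\in\mathbb{Z}$ and let $x\in R$ satisfy $4\le \mathrm{T}_k(x)<\infty$. Then there are integers $a_0,b_0,a_1,b_1$ and an integer $m\ge0$ such that $$x=\frac{a_0+\sqrt2\,b_0+i(a_1+\sqrt2\,b_1)}{\sqrt{2^m}},\qquad m\le\left\lfloor\frac{\mathrm{T}_k(x)+5}{2}\right\rfloor,$$ $$a_0^2+2b_0^2\le 2^m\quad\text{and}\quad a_1^2+2b_1^2\le 2^m.$$ -/

import Mathlib

/-- 2×2 complex matrices: linear operators on the state space of one qubit. -/
abbrev QMat : Type := Matrix (Fin 2) (Fin 2) ℂ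

/-- `ω = e^{iπ/4}`. -/
noncomputable def omega8 : ℂ := Complex.exp (Complex.I * (Real.pi / 4 : ℝ))

noncomputable def gateX : QMat := !![0, 1; 1, 0]

noncomputable def gateZ : QMat := !![1, 0; 0, -1]

noncomputable def gateY : QMat := Complex.I • (gateX * gateZ)

noncomputable def gateH : QMat := ((1 / Real.sqrt 2 : ℝ) : ℂ) • !![1, 1; 1, -1]

noncomputable def gateT : QMat := !![1, 0; 0, omega8]

noncomputable def gateP : QMat := gateT ^ 2

/-- The single-qubit Clifford unitaries: all finite products of the gates `X, Y, Z, H, P`.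
(Each of these gates has finite order, so this monoid is a group.) -/
noncomputable def cliffordUnitaries : Submonoid QMat :=
  Submonoid.closure {gateX, gateY, gateZ, gateH, gateP}

/-- `IsCliffordTProduct n V` : `V = C₁ T C₂ T ⋯ Cₙ T Cₙ₊₁` with all `Cᵢ` Clifford unitaries
(exactly `n` occurrences of `T`). -/
inductive IsCliffordTProduct : ℕ → QMat → Prop
  | clifford (C : QMat) (hC : C ∈ cliffordUnitaries) : IsCliffordTProduct 0 C
  | step (n : ℕ) (C V : QMat) (hC : C ∈ cliffordUnitaries) (hV : IsCliffordTProduct n V) :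
      IsCliffordTProduct (n + 1) (C * gateT * V)

/-- The T-count of `U`: the least `n` such that `U = e^{iα} C₁ T C₂ T ⋯ Cₙ T Cₙ₊₁` for a real
number `α` and Clifford unitaries `Cᵢ`; it is `∞` if there is no such `n`. -/
noncomputable def tCount (U : QMat) : ℕ∞ :=
  sInf {N : ℕ∞ | ∃ (n : ℕ) (α : ℝ) (V : QMat), N = n ∧ IsCliffordTProduct n V ∧
    U = Complex.exp (Complex.I * α) • V}

/-- The ring `ℤ[i, 1/√2]`, as a subring of `ℂ`. -/
noncomputable def ringZiSqrt : Subring ℂ :=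
  Subring.closure {Complex.I, ((1 / Real.sqrt 2 : ℝ) : ℂ)}

/-- The matrix `U[x,y,k]`. -/
noncomputable def matU (x y : ℂ) (k : ℤ) : QMat :=
  !![x, -(star y) * omega8 ^ k; y, star x * omega8 ^ k]

/-- `T_k(x)`: the minimal T-count of the exact unitaries `U[x,y,k]`, that is, the unitary matrices
of this form with `x, y ∈ ℤ[i, 1/√2]`; it is `∞` if there are none. -/
noncomputable def tCountElem (k : ℤ) (x : ℂ) : ℕ∞ :=
  sInf {N : ℕ∞ | ∃ y : ℂ, x ∈ ringZiSqrt ∧ y ∈ ringZiSqrt ∧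
    matU x y k ∈ Matrix.unitaryGroup (Fin 2) ℂ ∧ N = tCount (matU x y k)}

open Complex Matrix

/-! Conjugation by a Clifford gate permutes the Pauli matrices up to sign, and by `T` costs one
factor `√2`. With T-count `t`, the (0,0) entry of `U Z U*`, which is `2|x|² - 1`, thus lies in `√2⁻ᵗ
ℤ[√2]` (`ConjugatesLattice.normSq_entry`). Write `x = (p + iq)/√2ᵐ` with `p = a + b√2`, `q = c +
d√2` and `m` reduced. Then `2ᵐ|x|² = p² + q²` is not divisible by `4 = √2⁴`, which forces `2m < t +
6` (`denomExp_le`). The size bounds come from the rational part of `|x|² + |y|² = 1`, in which `x`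
and `y` both contribute sums of squares (`coeff_sum_le`). -/

/-- The real number `√2` as a complex number. -/
noncomputable def sqrtTwo : ℂ := (Real.sqrt 2 : ℂ)

lemma sqrtTwo_mul_self : sqrtTwo * sqrtTwo = 2 := by
  unfold sqrtTwo
  rw [← Complex.ofReal_mul, Real.mul_self_sqrt (by norm_num)]
  norm_num

lemma sqrtTwo_sq : sqrtTwo ^ 2 = 2 := by rw [sq, sqrtTwo_mul_self]

lemma sqrtTwo_ne_zero : sqrtTwo ≠ 0 := by
  intro h
  simpa [h] using sqrtTwo_mul_self

lemma star_sqrtTwo : star sqrtTwo = sqrtTwo := Complex.conj_ofReal _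

lemma sqrt_two_pow_cast (m : ℕ) : (Real.sqrt ((2 : ℝ) ^ m) : ℂ) = sqrtTwo ^ m := by
  rw [sqrtTwo, ← Complex.ofReal_pow]
  congr 1
  rw [Real.sqrt_eq_iff_mul_self_eq (by positivity) (by positivity), ← mul_pow,
    Real.mul_self_sqrt (by norm_num)]

/-- The embedding of `ℤ[√2]` into `ℂ`. -/
noncomputable def zsqrtTwoHom : ℤ√2 →+* ℂ :=
  Zsqrtd.lift ⟨sqrtTwo, by rw [sqrtTwo_mul_self]; norm_num⟩

/-- The subring `ℤ[√2]` of `ℂ`. -/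
noncomputable def zsqrtTwo : Subring ℂ := zsqrtTwoHom.range

lemma mem_zsqrtTwo {z : ℂ} : z ∈ zsqrtTwo ↔ ∃ a b : ℤ, z = a + b * sqrtTwo :=
  ⟨fun ⟨w, hw⟩ => ⟨w.re, w.im, hw.symm⟩, fun ⟨a, b, h⟩ => ⟨⟨a, b⟩, h.symm⟩⟩

lemma sqrtTwo_mem_zsqrtTwo : sqrtTwo ∈ zsqrtTwo := mem_zsqrtTwo.2 ⟨0, 1, by simp⟩

lemma zsqrtTwo_coeff_ext {a b c d : ℤ}
    (h : (a : ℂ) + b * sqrtTwo = c + d * sqrtTwo) : a = c ∧ b = d := by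
  have hinj : Function.Injective zsqrtTwoHom := by
    refine Zsqrtd.lift_injective _ fun n hn => ?_
    exact irrational_sqrt_two.ne_nat n.natAbs <| by
      rw [Real.sqrt_eq_iff_mul_self_eq (by norm_num) (by positivity)]
      have : ((n.natAbs : ℤ) * n.natAbs : ℤ) = 2 := by rw [Int.natAbs_mul_self', hn]
      exact_mod_cast this.symm
  have := @hinj ⟨a, b⟩ ⟨c, d⟩ h
  simpa [Zsqrtd.ext_iff] using this

/-! ### Denominator exponents -/

/-- `z` lies in `√2⁻ⁿ ℤ[√2, i]`. -/
def HasDenomExp (n : ℕ) (z : ℂ) : Prop :=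
  ∃ p ∈ zsqrtTwo, ∃ q ∈ zsqrtTwo, sqrtTwo ^ n * z = p + I * q

lemma HasDenomExp.add_right {n : ℕ} {z : ℂ} (h : HasDenomExp n z) (j : ℕ) :
    HasDenomExp (n + j) z := by
  obtain ⟨p, hp, q, hq, h⟩ := h
  have hs := pow_mem sqrtTwo_mem_zsqrtTwo j
  exact ⟨_, mul_mem hs hp, _, mul_mem hs hq, by linear_combination sqrtTwo ^ j * h⟩

lemma HasDenomExp.mono {n m : ℕ} {z : ℂ} (h : HasDenomExp n z) (hnm : n ≤ m) :
    HasDenomExp m z := by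
  obtain ⟨j, rfl⟩ := Nat.exists_eq_add_of_le hnm
  exact h.add_right j

lemma exists_hasDenomExp {z : ℂ} (hz : z ∈ ringZiSqrt) : ∃ n, HasDenomExp n z := by
  induction hz using Subring.closure_induction with
  | mem z hz =>
    rcases hz with rfl | rfl
    · exact ⟨0, 0, zero_mem _, 1, one_mem _, by simp⟩
    · refine ⟨1, 1, one_mem _, 0, zero_mem _, ?_⟩
      have h := sqrtTwo_ne_zero
      unfold sqrtTwo at h ⊢
      push_cast
      field_simp
      simp
  | zero => exact ⟨0, 0, zero_mem _, 0, zero_mem _, by simp⟩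
  | one => exact ⟨0, 1, one_mem _, 0, zero_mem _, by simp⟩
  | add x y _ _ hx hy =>
    obtain ⟨n, hx⟩ := hx
    obtain ⟨m, hy⟩ := hy
    obtain ⟨p, hp, q, hq, h⟩ := hx.mono (le_max_left n m)
    obtain ⟨p', hp', q', hq', h'⟩ := hy.mono (le_max_right n m)
    exact ⟨_, _, add_mem hp hp', _, add_mem hq hq', by linear_combination h + h'⟩
  | neg x _ hx =>
    obtain ⟨n, p, hp, q, hq, h⟩ := hx
    exact ⟨n, _, neg_mem hp, _, neg_mem hq, by linear_combination -h⟩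
  | mul x y _ _ hx hy =>
    obtain ⟨n, p, hp, q, hq, h⟩ := hx
    obtain ⟨m, p', hp', q', hq', h'⟩ := hy
    refine ⟨n + m, _, sub_mem (mul_mem hp hp') (mul_mem hq hq'), _,
      add_mem (mul_mem hp hq') (mul_mem hq hp'), ?_⟩
    linear_combination sqrtTwo ^ m * y * h + (p + I * q) * h' + q * q' * I_sq

/-! ### Action of the gates on the Pauli lattice -/

/-- The matrix `p X + q Y + r Z`. -/
noncomputable def pauliVec (p q r : ℂ) : QMat := !![r, p - I * q; p + I * q, -r]

/-- The `ℤ[√2]`-span of the Pauli matrices `X, Y, Z`. -/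
def pauliLattice : Set QMat :=
  {M | ∃ p ∈ zsqrtTwo, ∃ q ∈ zsqrtTwo, ∃ r ∈ zsqrtTwo, M = pauliVec p q r}

lemma omega8_eq : sqrtTwo * omega8 = 1 + I := by
  unfold omega8
  rw [mul_comm I, Complex.exp_mul_I, ← Complex.ofReal_cos, ← Complex.ofReal_sin,
    Real.cos_pi_div_four, Real.sin_pi_div_four]
  have := sqrtTwo_mul_self
  unfold sqrtTwo at *
  push_cast
  linear_combination (1 + I) / 2 * this

lemma star_omega8_eq : sqrtTwo * star omega8 = 1 - I := by
  have := congrArg star omega8_eq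
  simp only [star_mul', star_sqrtTwo, star_add, star_one] at this
  rw [this]
  simp [sub_eq_add_neg]

lemma omega8_sq : omega8 ^ 2 = I := by
  apply mul_left_cancel₀ (pow_ne_zero 2 sqrtTwo_ne_zero)
  rw [← mul_pow, omega8_eq, sqrtTwo_sq]
  linear_combination I_sq

lemma omega8_mul_star : omega8 * star omega8 = 1 := by
  apply mul_left_cancel₀ (pow_ne_zero 2 sqrtTwo_ne_zero)
  linear_combination star omega8 * sqrtTwo * omega8_eq + (1 + I) * star_omega8_eq - I_sq - sqrtTwo_sq

lemma gateP_eq : gateP = !![1, 0; 0, I] := by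
  simp [gateP, gateT, sq, ← omega8_sq]

lemma gateY_eq : gateY = !![0, -I; I, 0] := by
  ext i j
  fin_cases i <;> fin_cases j <;> simp [gateY, gateX, gateZ]

lemma sqrtTwo_smul_gateH : sqrtTwo • gateH = !![1, 1; 1, -1] := by
  have : sqrtTwo * ((1 / Real.sqrt 2 : ℝ) : ℂ) = 1 := by
    have h := sqrtTwo_ne_zero
    unfold sqrtTwo at h ⊢
    push_cast
    field_simp
  rw [gateH, smul_smul, this, one_smul]

lemma star_gateH : star gateH = gateH := by
  ext i j
  fin_cases i <;> fin_cases j <;> simp [gateH, Matrix.star_apply]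

lemma star_of_fin_two (a b c d : ℂ) :
    star (!![a, b; c, d] : QMat) = !![star a, star c; star b, star d] := by
  ext i j
  fin_cases i <;> fin_cases j <;> rfl

/-- The factor 2 clears the two factors `1/√2`, so conjugation by `H` can be checked on integer
matrices. -/
lemma two_smul_gateH_mul_mul (M : QMat) :
    (2 : ℂ) • (gateH * M * star gateH) = !![1, 1; 1, -1] * M * !![1, 1; 1, -1] := by
  rw [star_gateH, ← sqrtTwo_smul_gateH, ← sqrtTwo_mul_self]
  simp [smul_smul]

/-- Unitary matrices that map the Pauli lattice into `√2⁻ⁿ` times itself by conjugation. -/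
def ConjugatesLattice (n : ℕ) (U : QMat) : Prop :=
  U * star U = 1 ∧ ∀ M ∈ pauliLattice, sqrtTwo ^ n • (U * M * star U) ∈ pauliLattice

lemma ConjugatesLattice.mul {m n : ℕ} {U V : QMat} (hU : ConjugatesLattice m U)
    (hV : ConjugatesLattice n V) : ConjugatesLattice (m + n) (U * V) := by
  refine ⟨?_, fun M hM => ?_⟩
  · rw [star_mul, mul_assoc, ← mul_assoc V, hV.1, one_mul, hU.1]
  · convert hU.2 _ (hV.2 M hM) using 1
    simp [smul_smul, star_mul, mul_assoc, pow_add]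

lemma conjugatesLattice_one : ConjugatesLattice 0 1 := ⟨by simp, fun M hM => by simpa using hM⟩

lemma conjugatesLattice_gateX : ConjugatesLattice 0 gateX := by
  refine ⟨by simp [gateX, star_of_fin_two, Matrix.one_fin_two], ?_⟩
  rintro _ ⟨p, hp, q, hq, r, hr, rfl⟩
  refine ⟨p, hp, _, neg_mem hq, _, neg_mem hr, ?_⟩
  simp [gateX, star_of_fin_two, pauliVec]
  ring

lemma conjugatesLattice_gateY : ConjugatesLattice 0 gateY := by
  refine ⟨by simp [gateY_eq, star_of_fin_two, Matrix.one_fin_two], ?_⟩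
  rintro _ ⟨p, hp, q, hq, r, hr, rfl⟩
  refine ⟨_, neg_mem hp, q, hq, _, neg_mem hr, ?_⟩
  have h := I_sq
  ext i j
  fin_cases i <;> fin_cases j <;> simp [gateY_eq, star_of_fin_two, pauliVec] <;> grind

lemma conjugatesLattice_gateZ : ConjugatesLattice 0 gateZ := by
  refine ⟨by simp [gateZ, star_of_fin_two, Matrix.one_fin_two], ?_⟩
  rintro _ ⟨p, hp, q, hq, r, hr, rfl⟩
  refine ⟨_, neg_mem hp, _, neg_mem hq, r, hr, ?_⟩
  ext i j
  fin_cases i <;> fin_cases j <;> simp [gateZ, star_of_fin_two, pauliVec] <;> ring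

lemma conjugatesLattice_gateP : ConjugatesLattice 0 gateP := by
  refine ⟨by simp [gateP_eq, star_of_fin_two, Matrix.one_fin_two], ?_⟩
  rintro _ ⟨p, hp, q, hq, r, hr, rfl⟩
  refine ⟨_, neg_mem hq, p, hp, r, hr, ?_⟩
  have h := I_sq
  ext i j
  fin_cases i <;> fin_cases j <;> simp [gateP_eq, star_of_fin_two, pauliVec] <;> grind

lemma conjugatesLattice_gateH : ConjugatesLattice 0 gateH := by
  constructor
  · apply smul_right_injective QMat (two_ne_zero (α := ℂ))
    have h := two_smul_gateH_mul_mul 1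
    rw [mul_one] at h
    simp only [h]
    ext i j
    fin_cases i <;> fin_cases j <;> norm_num
  rintro _ ⟨p, hp, q, hq, r, hr, rfl⟩
  refine ⟨r, hr, _, neg_mem hq, p, hp, ?_⟩
  apply smul_right_injective QMat (two_ne_zero (α := ℂ))
  simp only [pow_zero, one_smul, two_smul_gateH_mul_mul]
  ext i j
  fin_cases i <;> fin_cases j <;> simp [pauliVec] <;> ring

/-- `T` fixes `Z` and rotates the `X`, `Y` plane by 45°: `X ↦ (X + Y)/√2`, `Y ↦ (Y - X)/√2`. -/
lemma conjugatesLattice_gateT : ConjugatesLattice 1 gateT := by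
  refine ⟨?_, ?_⟩
  · rw [gateT, star_of_fin_two, Matrix.mul_fin_two]
    simp only [omega8_mul_star]
    simp [Matrix.one_fin_two]
  rintro _ ⟨p, hp, q, hq, r, hr, rfl⟩
  refine ⟨_, sub_mem hp hq, _, add_mem hp hq, _, mul_mem sqrtTwo_mem_zsqrtTwo hr, ?_⟩
  rw [gateT, star_of_fin_two, pauliVec, pauliVec, Matrix.mul_fin_two, Matrix.mul_fin_two]
  ext i j
  fin_cases i <;> fin_cases j <;>
    simp only [Fin.zero_eta, Fin.mk_one, Fin.isValue, Matrix.smul_apply, Matrix.of_apply,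
      Matrix.cons_val', Matrix.cons_val_zero, Matrix.cons_val_one, Matrix.cons_val_fin_one,
      smul_eq_mul, pow_one, star_one, star_zero]
  · ring
  · linear_combination (p - I * q) * star_omega8_eq + q * I_sq
  · linear_combination (p + I * q) * omega8_eq + q * I_sq
  · linear_combination -sqrtTwo * r * omega8_mul_star

lemma conjugatesLattice_of_mem_cliffordUnitaries {C : QMat} (hC : C ∈ cliffordUnitaries) :
    ConjugatesLattice 0 C := by
  induction hC using Submonoid.closure_induction with
  | mem C hC =>
    rcases hC with rfl | rfl | rfl | rfl | rfl
    exacts [conjugatesLattice_gateX, conjugatesLattice_gateY, conjugatesLattice_gateZ,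
      conjugatesLattice_gateH, conjugatesLattice_gateP]
  | one => exact conjugatesLattice_one
  | mul A B _ _ hA hB => exact hA.mul hB

lemma IsCliffordTProduct.conjugatesLattice {n : ℕ} {V : QMat} (h : IsCliffordTProduct n V) :
    ConjugatesLattice n V := by
  induction h with
  | clifford C hC => exact conjugatesLattice_of_mem_cliffordUnitaries hC
  | step n C V hC _ ih =>
    have := ((conjugatesLattice_of_mem_cliffordUnitaries hC).mul conjugatesLattice_gateT).mul ih
    rwa [zero_add, add_comm] at this

/-! ### From T-count to the denominator of `|x|²` -/

lemma ConjugatesLattice.normSq_entry {n : ℕ} {V : QMat} (h : ConjugatesLattice n V) :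
    sqrtTwo ^ (n + 2) * (V 0 0 * star (V 0 0)) ∈ zsqrtTwo := by
  -- Conjugating `Z` gives `|V₀₀|² - |V₀₁|²` in the corner; as the row has norm 1, this is `2|V₀₀|²
  -- - 1`.
  obtain ⟨p, hp, q, hq, r, hr, e⟩ := h.2 (pauliVec 0 0 1)
    ⟨0, zero_mem _, 0, zero_mem _, 1, one_mem _, rfl⟩
  have e0 := congrFun (congrFun e 0) 0
  have u0 := congrFun (congrFun h.1 0) 0
  simp [pauliVec, Matrix.mul_apply, Fin.sum_univ_two] at e0 u0
  convert add_mem hr (pow_mem sqrtTwo_mem_zsqrtTwo n) using 1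
  rw [← e0, pow_add, sqrtTwo_sq]
  simp only [RCLike.star_def]
  linear_combination sqrtTwo ^ n * u0

lemma normSq_mem_of_tCount {U : QMat} {n : ℕ} (h : tCount U = n) :
    sqrtTwo ^ (n + 2) * (U 0 0 * star (U 0 0)) ∈ zsqrtTwo := by
  -- The infimum of the empty set is `⊤`, so a finite value is attained.
  have hne : {N : ℕ∞ | ∃ (n : ℕ) (α : ℝ) (V : QMat), N = n ∧ IsCliffordTProduct n V ∧
      U = Complex.exp (Complex.I * α) • V}.Nonempty := by
    by_contra hc
    rw [Set.not_nonempty_iff_eq_empty] at hc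
    rw [tCount, hc, sInf_empty] at h
    exact ENat.top_ne_natCast n h
  obtain ⟨n', α, V, hN, hV, rfl⟩ := csInf_mem hne
  obtain rfl : n = n' := by exact_mod_cast h.symm.trans hN
  convert hV.conjugatesLattice.normSq_entry using 2
  have hα : Complex.exp (I * α) * star (Complex.exp (I * α)) = 1 := by
    rw [RCLike.star_def, ← Complex.exp_conj, ← Complex.exp_add]
    simp
  simp only [Matrix.smul_apply, smul_eq_mul, star_mul']
  linear_combination (V 0 0 * star (V 0 0)) * hα

lemma exists_of_tCountElem_eq {k : ℤ} {x : ℂ} {n : ℕ} (h : tCountElem k x = n) :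
    ∃ y ∈ ringZiSqrt, matU x y k ∈ Matrix.unitaryGroup (Fin 2) ℂ ∧ tCount (matU x y k) = n := by
  have hne : {N : ℕ∞ | ∃ y : ℂ, x ∈ ringZiSqrt ∧ y ∈ ringZiSqrt ∧
      matU x y k ∈ Matrix.unitaryGroup (Fin 2) ℂ ∧ N = tCount (matU x y k)}.Nonempty := by
    by_contra hc
    rw [Set.not_nonempty_iff_eq_empty] at hc
    rw [tCountElem, hc, sInf_empty] at h
    exact ENat.top_ne_natCast n h
  obtain ⟨y, -, hy, hU, hN⟩ := csInf_mem hne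
  exact ⟨y, hy, hU, hN.symm.trans h⟩

/-! ### Divisibility and size of `p² + q²` -/

/-- If just one of `a`, `c` is odd, the first sum is odd. If both are, it is `2(1 + b² + d²)` mod 4,
so `b + d` is odd, and with it `ab + cd`. -/
lemma not_four_dvd_norm {a b c d : ℤ} (hac : ¬(2 ∣ a ∧ 2 ∣ c))
    (h1 : 4 ∣ a ^ 2 + 2 * b ^ 2 + (c ^ 2 + 2 * d ^ 2)) (h2 : 4 ∣ 2 * (a * b + c * d)) : False := by
  have key : ∀ a b c d : ZMod 4, a ^ 2 + 2 * b ^ 2 + (c ^ 2 + 2 * d ^ 2) = 0 →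
      2 * (a * b + c * d) = 0 → 2 * a = 0 ∧ 2 * c = 0 := by decide
  have := key a b c d
    (by exact_mod_cast (ZMod.intCast_zmod_eq_zero_iff_dvd _ 4).2 h1)
    (by exact_mod_cast (ZMod.intCast_zmod_eq_zero_iff_dvd _ 4).2 h2)
  have ha := (ZMod.intCast_zmod_eq_zero_iff_dvd (2 * a) 4).1 (by exact_mod_cast this.1)
  have hc := (ZMod.intCast_zmod_eq_zero_iff_dvd (2 * c) 4).1 (by exact_mod_cast this.2)
  push_cast at ha hc
  omega

/-- The square of the absolute value of an element of `√2⁻ⁿ ℤ[√2, i]`. -/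
lemma mul_star_of_denomExp {n : ℕ} {z : ℂ} {a b c d : ℤ}
    (h : sqrtTwo ^ n * z = (a + b * sqrtTwo) + I * (c + d * sqrtTwo)) :
    2 ^ n * (z * star z) = ((a ^ 2 + 2 * b ^ 2 + (c ^ 2 + 2 * d ^ 2) : ℤ) : ℂ) +
      ((2 * (a * b + c * d) : ℤ) : ℂ) * sqrtTwo := by
  have h' : sqrtTwo ^ n * star z = (a + b * sqrtTwo) - I * (c + d * sqrtTwo) := by
    have := congrArg star h
    have hs : (starRingEnd ℂ) sqrtTwo = sqrtTwo := star_sqrtTwo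
    simpa [hs, sub_eq_add_neg] using this
  have e : (2 : ℂ) ^ n = sqrtTwo ^ n * sqrtTwo ^ n := by rw [← mul_pow, sqrtTwo_mul_self]
  rw [e]
  push_cast
  linear_combination (sqrtTwo ^ n * star z) * h +
    ((a + b * sqrtTwo) + I * (c + d * sqrtTwo)) * h' - (c + d * sqrtTwo) ^ 2 * I_sq +
    ((b : ℂ) ^ 2 + d ^ 2) * sqrtTwo_sq

lemma denomExp_le {n t : ℕ} {z : ℂ} {a b c d : ℤ}
    (h : sqrtTwo ^ n * z = (a + b * sqrtTwo) + I * (c + d * sqrtTwo))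
    (hac : ¬(2 ∣ a ∧ 2 ∣ c)) (ht : sqrtTwo ^ (t + 2) * (z * star z) ∈ zsqrtTwo) :
    2 * n ≤ t + 5 := by
  by_contra hlt
  obtain ⟨j, hj⟩ := Nat.exists_eq_add_of_le (show t + 6 ≤ 2 * n by omega)
  obtain ⟨e, f, hef⟩ := mem_zsqrtTwo.1 (mul_mem (pow_mem sqrtTwo_mem_zsqrtTwo j) ht)
  have e2 : (2 : ℂ) ^ n = 4 * (sqrtTwo ^ j * sqrtTwo ^ (t + 2)) := by
    rw [← sqrtTwo_sq, ← pow_mul, hj, show t + 6 + j = 4 + (j + (t + 2)) by ring, pow_add, pow_add]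
    linear_combination (sqrtTwo ^ 2 + 2) * sqrtTwo ^ j * sqrtTwo ^ (t + 2) * sqrtTwo_sq
  have hN := mul_star_of_denomExp h
  have := zsqrtTwo_coeff_ext (a := 4 * e) (b := 4 * f) <| by
    rw [← hN, e2]
    push_cast
    linear_combination -4 * hef
  exact not_four_dvd_norm hac ⟨e, this.1.symm⟩ ⟨f, this.2.symm⟩

lemma coeff_sum_le {n : ℕ} {x y : ℂ} {a b c d : ℤ} (hy : y ∈ ringZiSqrt)
    (h : sqrtTwo ^ n * x = (a + b * sqrtTwo) + I * (c + d * sqrtTwo))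
    (hxy : x * star x + y * star y = 1) : a ^ 2 + 2 * b ^ 2 + (c ^ 2 + 2 * d ^ 2) ≤ 2 ^ n := by
  obtain ⟨j, hj⟩ := exists_hasDenomExp hy
  -- Any exponent above both `n` and `j` would do; the excess `2j` over `n` scales the terms of `x`
  -- by `2^(2j)`.
  obtain ⟨p, hp, q, hq, e⟩ := hj.mono (show j ≤ n + 2 * j by omega)
  obtain ⟨a', b', rfl⟩ := mem_zsqrtTwo.1 hp
  obtain ⟨c', d', rfl⟩ := mem_zsqrtTwo.1 hq
  have h1 := mul_star_of_denomExp h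
  have h2 := mul_star_of_denomExp e
  have := (zsqrtTwo_coeff_ext
    (a := 2 ^ (2 * j) * (a ^ 2 + 2 * b ^ 2 + (c ^ 2 + 2 * d ^ 2)) +
      (a' ^ 2 + 2 * b' ^ 2 + (c' ^ 2 + 2 * d' ^ 2)))
    (b := 2 ^ (2 * j) * (2 * (a * b + c * d)) + 2 * (a' * b' + c' * d'))
    (c := 2 ^ (2 * j) * 2 ^ n) (d := 0) <| by
      push_cast at h1 h2 ⊢
      rw [pow_add] at h2
      linear_combination (2 : ℂ) ^ n * 2 ^ (2 * j) * hxy - (2 : ℂ) ^ (2 * j) * h1 - h2).1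
  refine le_of_mul_le_mul_left (a := (2 : ℤ) ^ (2 * j)) ?_ (by positivity)
  rw [← this]
  exact le_add_of_nonneg_right (by positivity)

lemma exists_reduced_denomExp {n : ℕ} {z : ℂ} (h : HasDenomExp n z) :
    ∃ (m : ℕ) (a b c d : ℤ), sqrtTwo ^ m * z = (a + b * sqrtTwo) + I * (c + d * sqrtTwo) ∧
      (m = 0 ∨ ¬(2 ∣ a ∧ 2 ∣ c)) := by
  induction n with
  | zero =>
    obtain ⟨p, hp, q, hq, e⟩ := h
    obtain ⟨a, b, rfl⟩ := mem_zsqrtTwo.1 hp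
    obtain ⟨c, d, rfl⟩ := mem_zsqrtTwo.1 hq
    exact ⟨0, a, b, c, d, e, Or.inl rfl⟩
  | succ n ih =>
    obtain ⟨p, hp, q, hq, e⟩ := h
    obtain ⟨a, b, rfl⟩ := mem_zsqrtTwo.1 hp
    obtain ⟨c, d, rfl⟩ := mem_zsqrtTwo.1 hq
    by_cases hac : 2 ∣ a ∧ 2 ∣ c
    · obtain ⟨⟨a', rfl⟩, c', rfl⟩ := hac
      -- Cancel one `√2`: `2a' + b√2 = √2 (b + a'√2)`.
      refine ih ⟨_, mem_zsqrtTwo.2 ⟨b, a', rfl⟩, _, mem_zsqrtTwo.2 ⟨d, c', rfl⟩, ?_⟩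
      apply mul_left_cancel₀ sqrtTwo_ne_zero
      push_cast at e
      linear_combination e - (a' + I * c') * sqrtTwo_sq
    · exact ⟨n + 1, a, b, c, d, e, Or.inr hac⟩

theorem mainTheorem3 (k : ℤ) (x : ℂ) (hx : x ∈ ringZiSqrt)
    (h4 : 4 ≤ tCountElem k x) (hfin : tCountElem k x < ⊤) :
    ∃ (a₀ b₀ a₁ b₁ : ℤ) (m : ℕ),
      x = (((a₀ : ℂ) + (Real.sqrt 2 : ℂ) * b₀) +
            Complex.I * ((a₁ : ℂ) + (Real.sqrt 2 : ℂ) * b₁)) / (Real.sqrt ((2 : ℝ) ^ m) : ℂ) ∧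
      (m : ℤ) ≤ ⌊(((tCountElem k x).toNat : ℝ) + 5) / 2⌋ ∧
      a₀ ^ 2 + 2 * b₀ ^ 2 ≤ 2 ^ m ∧
      a₁ ^ 2 + 2 * b₁ ^ 2 ≤ 2 ^ m := by
  obtain ⟨t, ht⟩ := ENat.ne_top_iff_exists.1 hfin.ne
  obtain ⟨y, hy, hU, hT⟩ := exists_of_tCountElem_eq ht.symm
  have hn := normSq_mem_of_tCount hT
  have hxy : x * star x + y * star y = 1 := by
    have h := congrFun (congrFun (Matrix.mem_unitaryGroup_iff'.1 hU) 0) 0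
    simp [matU, Matrix.mul_apply, Fin.sum_univ_two] at h
    simp only [RCLike.star_def]
    linear_combination h
  obtain ⟨n, hd⟩ := exists_hasDenomExp hx
  obtain ⟨m, a, b, c, d, e, hm⟩ := exists_reduced_denomExp hd
  have hle : 2 * m ≤ t + 5 := by
    rcases hm with rfl | hac
    · omega
    · exact denomExp_le e hac hn
  have hsum := coeff_sum_le hy e hxy
  refine ⟨a, b, c, d, m, ?_, ?_, ?_, ?_⟩
  · rw [sqrt_two_pow_cast, eq_div_iff (pow_ne_zero _ sqrtTwo_ne_zero)]
    unfold sqrtTwo at e ⊢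
    linear_combination e
  · rw [← ht, Int.le_floor, ENat.toNat_natCast, le_div_iff₀ (by norm_num)]
    push_cast
    have : (2 * m : ℝ) ≤ t + 5 := by exact_mod_cast hle
    linarith
  · nlinarith [sq_nonneg c, sq_nonneg d]
  · nlinarith [sq_nonneg a, sq_nonneg b]
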